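/- For every real $0<\lambda<1$ there exists $\delta=\delta(\lambda)>0$, depending on $\lambda$ only, such that for every odd prime $p$ there is a constant $C=C(\lambda,p)>0$ with the following property. For every integer $n\ge 1$, every real interval $\mathcal I$ of length at most $p^{n(1-\lambda)}$, and all $a,b\in(\mathbb Z/p^n\mathbb Z)^\times$, $$\left|\frac{1}{p^{n/2}}\sum_{\substack{x\in\mathcal I\cap\mathbb Z\\ p\nmid x}} e_{p^n}(ax+b\overline{x})\right|\le C\,p^{-n\delta},$$ where $e_{p^n}(z)=e^{2\pi i z/p^n}$ and $\overline{x}$ denotes the inverse of $x$ modulo $p^n$. -/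

import Mathlib

/-- The normalized incomplete Kloosterman sum
`p^(-n/2) * ∑ e_{p^n}(a x + b x̄)` over the integers `x` in the real interval `[s, t]` that are
coprime to `p`. Here `ZMod.stdAddChar` on `ZMod (p ^ n)` is `z ↦ exp (2 π i z / p ^ n)`, and `⁻¹` is
the inverse modulo `p ^ n`, which is genuine since only `x` coprime to `p` occur. -/
noncomputable def incompleteKloosterman (p n : ℕ) [Fact p.Prime]
    (a b : (ZMod (p ^ n))ˣ) (s t : ℝ) : ℂ :=
  (((p : ℝ) ^ (-((n : ℝ) / 2)) : ℝ) : ℂ) *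
    ∑ x ∈ (Finset.Icc ⌈s⌉ ⌊t⌋).filter (fun x : ℤ => ¬ (p : ℤ) ∣ x),
      ZMod.stdAddChar ((a : ZMod (p ^ n)) * (x : ZMod (p ^ n)) +
        (b : ZMod (p ^ n)) * (x : ZMod (p ^ n))⁻¹)

/-!
Write `q = p ^ n`, `e(z) = exp(2πiz/q)` and `Kl(u) = ∑ e(ux + bx⁻¹)`, the sum being over the units
`x` of `ℤ/q`. Completing the sum over the interval gives a weighted sum of the `Kl(a + h)`, and
square-root cancellation in each of these yields only `√q log q`. The further saving comes from
cancellation between neighbouring frequencies `h`, as `Kl(u)` is essentially `√q e(2√(bu))` and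
the `p`-adic square root is analytic.

The averaging over neighbouring frequencies is arranged before completion. On an interval of
length `N` starting at `A`, the weight `W(x) = V⁻¹ ∑_{v < V} e(p^w v (x - A))` stays within `1/2`
of `1` and varies slowly, as soon as `p^w V N` is small compared with `q`. By partial summation it
may therefore be inserted into the sum, and the Pólya–Vinogradov method
(`norm_sum_range_le_of_norm_dft_le`) reduces everything to the Fourier coefficients of the
weighted summand. These are the averages over `v < V` of `Kl(u + p^w v)`, twisted by additive
characters in `v`.

Such an average is bounded in `norm_sum_shifted_kloosterman_le`, where the Kloosterman sums vanish
if `u` is not a unit. Let `T` be the Taylor polynomial of `√(1 - 4y)`, whose coefficients are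
integers given by the Catalan numbers. If `p^w` is sufficiently nilpotent for the degree of `T`,
then `u + p^w v = u τ²` with `τ = T(βv)` and `β = -p^w/(4u)`; the substitution `x = z τ⁻¹` turns
`ux τ² + b x⁻¹` into `(uz + bz⁻¹) τ`. A stationary phase argument
(`sum_units_mul_sq_eq_sum_stationary`) restricts `z` to about `√q` values which do not depend on
`v`, and for which `uz + bz⁻¹` is a unit. For every such `z` the phase is a polynomial in `v`,
whose leading coefficient is a known power of `p` up to a bounded factor. Weyl differencing
(`norm_weylSum_le`) saves a power of `q` in the sum over `v`. As the modulus is a prime power, all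
that has to be known about the leading coefficients arising in the differencing is their `p`-adic
valuation, which is large only for a small proportion of the shifts.
-/

open Finset Polynomial
open scoped ZMod

/-! ### Partial summation -/

theorem norm_sum_mul_le_of_partial_sums {f g : ℕ → ℂ} {K M D : ℝ} {N : ℕ}
    (hM : ∀ k ≤ N, ‖∑ j ∈ range k, g j‖ ≤ M) (hK : 0 ≤ K) (hf : ∀ j < N, ‖f j‖ ≤ K)
    (hD0 : 0 ≤ D) (hD : ∀ j, j + 1 < N → ‖f (j + 1) - f j‖ ≤ D) :
    ‖∑ j ∈ range N, f j * g j‖ ≤ (K + N * D) * M := by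
  have hM0 : 0 ≤ M := (norm_nonneg _).trans (hM 0 (Nat.zero_le _))
  rcases Nat.eq_zero_or_pos N with rfl | hN
  · simpa using mul_nonneg hK hM0
  have h := Finset.sum_range_by_parts f g N
  simp only [smul_eq_mul] at h
  rw [h]
  have h1 : ‖f (N - 1) * ∑ i ∈ range N, g i‖ ≤ K * M := by
    rw [norm_mul]
    exact mul_le_mul (hf _ (by omega)) (hM _ le_rfl) (norm_nonneg _)
      ((norm_nonneg _).trans (hf (N - 1) (by omega)))
  have h2 : ‖∑ i ∈ range (N - 1), (f (i + 1) - f i) * ∑ j ∈ range (i + 1), g j‖ ≤ N * D * M := by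
    refine (norm_sum_le_of_le _ (n := fun _ => D * M) fun i hi => ?_).trans ?_
    · rw [norm_mul]
      rw [mem_range] at hi
      exact mul_le_mul (hD _ (by omega)) (hM _ (by omega)) (norm_nonneg _) hD0
    · rw [sum_const, card_range, nsmul_eq_mul, mul_assoc]
      refine mul_le_mul_of_nonneg_right ?_ (by positivity)
      exact_mod_cast Nat.sub_le _ _
  calc _ ≤ _ := norm_sub_le _ _
    _ ≤ K * M + N * D * M := add_le_add h1 h2
    _ = _ := by ring

/-! ### Completion of incomplete sums -/

theorem ZMod.sum_univ_eq_sum_range_val {M : Type*} [AddCommMonoid M] (q : ℕ) [NeZero q]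
    (f : ℕ → M) : ∑ k : ZMod q, f k.val = ∑ i ∈ range q, f i := by
  refine sum_nbij' (fun k => k.val) (fun i => (i : ZMod q)) ?_ ?_ ?_ ?_ ?_
  · intro k _; exact mem_range.2 (ZMod.val_lt k)
  · intro i _; exact mem_univ _
  · intro k _; simp
  · intro i hi; exact ZMod.val_cast_of_lt (mem_range.1 hi)
  · intro k _; rfl

theorem norm_stdAddChar_intCast_sub_one_le (q : ℕ) [NeZero q] (j : ℤ) :
    ‖ZMod.stdAddChar (j : ZMod q) - 1‖ ≤ 2 * Real.pi * |(j : ℝ)| / q := by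
  rw [ZMod.stdAddChar_coe]
  have := Real.norm_exp_I_mul_ofReal_sub_one_le (x := 2 * Real.pi * j / q)
  have e : Complex.I * ((2 * Real.pi * j / q : ℝ) : ℂ) = 2 * Real.pi * Complex.I * j / q := by
    push_cast; ring
  rw [e] at this
  refine this.trans (le_of_eq ?_)
  rw [Real.norm_eq_abs, abs_div, abs_mul, abs_of_pos (by positivity : (0:ℝ) < 2 * Real.pi)]
  simp

/-- The norm is `2 |sin (π k / q)|`, and the lower bound is four times the distance
from `k / q` to the nearest integer. -/
theorem norm_stdAddChar_sub_one_ge (q : ℕ) [NeZero q] (k : ZMod q) :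
    4 * min (k.val : ℝ) (q - k.val) / q ≤ ‖ZMod.stdAddChar k - 1‖ := by
  have hq : (0 : ℝ) < q := by exact_mod_cast Nat.pos_of_ne_zero (NeZero.ne q)
  have hk : (k.val : ℝ) ≤ q := by exact_mod_cast (ZMod.val_lt k).le
  have e : ZMod.stdAddChar k =
      Complex.exp (Complex.I * ((2 * (Real.pi * k.val / q) : ℝ) : ℂ)) := by
    conv_lhs => rw [← ZMod.natCast_zmod_val k, ← Int.cast_natCast, ZMod.stdAddChar_coe]
    push_cast
    ring_nf
  rw [e, Complex.norm_exp_I_mul_ofReal_sub_one]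
  rw [mul_div_cancel_left₀ _ (two_ne_zero), norm_mul, Real.norm_eq_abs, Real.norm_eq_abs,
    abs_of_pos (by norm_num : (0:ℝ) < 2)]
  have key : ∀ x : ℝ, 0 ≤ x → x ≤ q / 2 → 2 * x / q ≤ Real.sin (Real.pi * x / q) := by
    intro x hx0 hx
    have := Real.mul_le_sin (x := Real.pi * x / q) (by positivity) (by
      rw [div_le_div_iff₀ hq (by norm_num)]
      nlinarith [Real.pi_pos])
    refine le_trans (le_of_eq ?_) this
    field_simp
  have : 2 * min (k.val : ℝ) (q - k.val) / q ≤ |Real.sin (Real.pi * k.val / q)| := by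
    rcases le_total (k.val : ℝ) (q / 2) with h | h
    · rw [min_eq_left (by linarith)]
      exact (key _ (by positivity) h).trans (le_abs_self _)
    · rw [min_eq_right (by linarith)]
      have := key (q - k.val) (by linarith) (by linarith)
      have e2 : Real.pi * (q - k.val) / q = Real.pi - Real.pi * k.val / q := by
        field_simp
      rw [e2, Real.sin_pi_sub] at this
      exact this.trans (le_abs_self _)
  calc _ = 2 * (2 * min (k.val : ℝ) (q - k.val) / q) := by ring
    _ ≤ _ := by linarith

/-- The minimum of `k` and `q - k` is replaced by a harmonic sum, so that the total over all `k ≠ 0`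
can be computed. -/
theorem norm_sum_pow_stdAddChar_le (q : ℕ) [NeZero q] {k : ZMod q} (hk : k ≠ 0) (N : ℕ) :
    ‖∑ j ∈ range N, ZMod.stdAddChar k ^ j‖ ≤ q / 2 * ((k.val : ℝ)⁻¹ + ((q : ℝ) - k.val)⁻¹) := by
  have hq : (0 : ℝ) < q := by exact_mod_cast Nat.pos_of_ne_zero (NeZero.ne q)
  have hk1 : (k.val : ℝ) < q := by exact_mod_cast (ZMod.val_lt k)
  have hk0 : (0 : ℝ) < k.val := by
    exact_mod_cast Nat.pos_of_ne_zero (by rwa [Ne, ZMod.val_eq_zero])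
  have hmin : 0 < min (k.val : ℝ) (q - k.val) := lt_min hk0 (by linarith)
  have hlow := norm_stdAddChar_sub_one_ge q k
  have hpos : 0 < 4 * min (k.val : ℝ) (q - k.val) / q := by positivity
  have hne : ZMod.stdAddChar k ≠ (1 : ℂ) := by
    intro h
    rw [h, sub_self, norm_zero] at hlow
    linarith
  rw [geom_sum_eq hne, norm_div]
  have h2 : ‖ZMod.stdAddChar k ^ N - (1 : ℂ)‖ ≤ 2 := by
    refine (norm_sub_le _ _).trans ?_
    rw [norm_pow, AddChar.norm_apply, one_pow, norm_one]
    norm_num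
  calc _ ≤ 2 / (4 * min (k.val : ℝ) (q - k.val) / q) :=
        div_le_div₀ (by norm_num) h2 hpos hlow
    _ = q / 2 * (min (k.val : ℝ) (q - k.val))⁻¹ := by field_simp; norm_num
    _ ≤ _ := by
      refine mul_le_mul_of_nonneg_left ?_ (by positivity)
      rcases min_choice (k.val : ℝ) (q - k.val) with h | h <;> rw [h]
      · have : 0 < ((q : ℝ) - k.val)⁻¹ := inv_pos.2 (by linarith)
        linarith
      · have : 0 < (k.val : ℝ)⁻¹ := inv_pos.2 hk0
        linarith

/-- The Pólya–Vinogradov method: a bound for all Fourier coefficients of `Φ` bounds the sums of `Φ`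
over intervals, at the cost of a logarithm. -/
theorem norm_sum_range_le_of_norm_dft_le (q : ℕ) [NeZero q] {Φ : ZMod q → ℂ} {B : ℝ}
    (hB : ∀ k, ‖𝓕 Φ k‖ ≤ B) (A : ZMod q) {N : ℕ} (hN : N ≤ q) :
    ‖∑ j ∈ range N, Φ (A + j)‖ ≤ B * (2 + Real.log q) := by
  have hq : (0 : ℝ) < q := by exact_mod_cast Nat.pos_of_ne_zero (NeZero.ne q)
  have hB0 : 0 ≤ B := (norm_nonneg _).trans (hB 0)
  have inv : ∀ y, Φ y = (q : ℂ)⁻¹ * ∑ k, ZMod.stdAddChar (k * y) * 𝓕 Φ k := by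
    intro y
    conv_lhs => rw [← LinearEquiv.symm_apply_apply ZMod.dft Φ]
    rw [ZMod.invDFT_apply]
    simp
  have e : ∑ j ∈ range N, Φ (A + j) = (q : ℂ)⁻¹ * ∑ k, 𝓕 Φ k * ZMod.stdAddChar (k * A) *
      ∑ j ∈ range N, ZMod.stdAddChar k ^ j := by
    simp_rw [inv, ← mul_sum]
    rw [sum_comm]
    congr 1
    refine sum_congr rfl fun k _ => ?_
    rw [mul_sum]
    refine sum_congr rfl fun j _ => ?_
    rw [mul_add, AddChar.map_add_eq_mul, mul_comm k (j : ZMod q), ← nsmul_eq_mul,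
      AddChar.map_nsmul_eq_pow]
    ring
  -- The bound for the geometric sum at frequency `i`; `i = 0` is the trivial bound.
  set c : ℕ → ℝ := fun i => if i = 0 then (q : ℝ) else q / 2 * ((i : ℝ)⁻¹ + ((q : ℝ) - i)⁻¹)
    with hc
  have hG : ∀ k : ZMod q, ‖∑ j ∈ range N, ZMod.stdAddChar k ^ j‖ ≤ c k.val := by
    intro k
    by_cases hk : k = 0
    · subst hk
      simp only [hc, AddChar.map_zero_eq_one, one_pow, sum_const, card_range, ZMod.val_zero]
      simpa using hN
    · have : k.val ≠ 0 := by rwa [Ne, ZMod.val_eq_zero]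
      simp only [hc, this, if_false]
      exact norm_sum_pow_stdAddChar_le q hk N
  have hcsum : ∑ i ∈ range q, c i ≤ q * (2 + Real.log q) := by
    obtain ⟨r, hr⟩ : ∃ r, q = r + 1 := ⟨q - 1, by have := NeZero.ne q; omega⟩
    have hrlog : (harmonic r : ℝ) ≤ 1 + Real.log q := by
      rcases Nat.eq_zero_or_pos r with h | h
      · subst h; simp [hr]
      · refine (harmonic_le_one_add_log r).trans ?_
        have : Real.log r ≤ Real.log q :=
          Real.log_le_log (by exact_mod_cast h) (by rw [hr]; push_cast; linarith)
        linarith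
    have h1 : ∑ i ∈ range r, ((i + 1 : ℕ) : ℝ)⁻¹ = harmonic r := by
      simp [harmonic]
    have h2 : ∑ i ∈ range r, ((q : ℝ) - (i + 1 : ℕ))⁻¹ = harmonic r := by
      rw [← h1, ← sum_range_reflect]
      refine sum_congr rfl fun i hi => ?_
      rw [mem_range] at hi
      congr 1
      rw [sub_eq_iff_eq_add]
      have : q = (r - 1 - i + 1) + (i + 1) := by omega
      have h' : (r - 1 - (r - 1 - i) + 1) = i + 1 := by omega
      rw [show (q : ℝ) = (((r - 1 - i + 1) + (i + 1) : ℕ) : ℝ) by rw [← this]]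
      push_cast
      ring
    have : ∑ i ∈ range q, c i = q + q * harmonic r := by
      rw [show range q = range (r + 1) by rw [hr], sum_range_succ']
      simp only [hc, Nat.succ_ne_zero, if_false, if_true, ← mul_sum, sum_add_distrib, h1, h2]
      ring
    rw [this]
    nlinarith
  rw [e, norm_mul, norm_inv, Complex.norm_natCast]
  calc (q : ℝ)⁻¹ * ‖∑ k, 𝓕 Φ k * ZMod.stdAddChar (k * A) *
      ∑ j ∈ range N, ZMod.stdAddChar k ^ j‖
      ≤ (q : ℝ)⁻¹ * ∑ k : ZMod q, B * c k.val := by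
        refine mul_le_mul_of_nonneg_left (norm_sum_le_of_le _ fun k _ => ?_) (by positivity)
        rw [norm_mul, norm_mul, AddChar.norm_apply, mul_one]
        exact mul_le_mul (hB k) (hG k) (norm_nonneg _) hB0
    _ = (q : ℝ)⁻¹ * (B * ∑ i ∈ range q, c i) := by
        rw [← mul_sum, ZMod.sum_univ_eq_sum_range_val q c]
    _ ≤ (q : ℝ)⁻¹ * (B * (q * (2 + Real.log q))) := by gcongr
    _ = B * (2 + Real.log q) := by field_simp

/-! ### The Taylor polynomial of `√(1 - 4y)` -/

/-- The polynomial `1 - 2 ∑_{j < d} C_j y^(j+1)`, with `C_j` the Catalan numbers, which is the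
Taylor polynomial of degree `d` of `√(1 - 4 y)`. -/
noncomputable def sqrtTaylor (R : Type*) [CommRing R] (d : ℕ) : R[X] :=
  1 - 2 * ∑ j ∈ range d, C (catalan j : R) * X ^ (j + 1)

/-- `sqrtTaylor` squares to `1 - 4y` as far as its degree permits: the Catalan generating function
satisfies `C = 1 + y C²`, so that `(1 - 2yC)² = 1 - 4y`. -/
theorem sqrtTaylor_eval_sq {R : Type*} [CommRing R] (d : ℕ) {y : R} (hy : y ^ (d + 1) = 0) :
    (sqrtTaylor R d).eval y ^ 2 = 1 - 4 * y := by
  set P : R[X] := ∑ j ∈ range d, C (catalan j : R) * X ^ j with hP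
  have hcoeff : ∀ m < d, P.coeff m = catalan m := by
    intro m hm
    simp [hP, coeff_X_pow, hm]
  have hdvd : X ^ d ∣ P - 1 - X * P ^ 2 := by
    rw [X_pow_dvd_iff]
    intro m hm
    rw [coeff_sub, coeff_sub, hcoeff m hm]
    rcases m with _ | m
    · simp
    · rw [coeff_X_mul, sq, coeff_mul, catalan_succ', coeff_one, if_neg (by omega)]
      push_cast
      rw [sub_zero, sub_eq_zero]
      refine sum_congr rfl fun ij hij => ?_
      rw [HasAntidiagonal.mem_antidiagonal] at hij
      rw [hcoeff _ (by omega), hcoeff _ (by omega)]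
  obtain ⟨Q, hQ⟩ := hdvd
  have h1 : P.eval y - 1 - y * P.eval y ^ 2 = y ^ d * Q.eval y := by
    have := congrArg (eval y) hQ
    simpa using this
  have h2 : (sqrtTaylor R d).eval y = 1 - 2 * (y * P.eval y) := by
    simp only [sqrtTaylor, hP, eval_sub, eval_one, eval_mul, eval_finsetSum, eval_C, eval_pow,
      eval_X, eval_ofNat, mul_sum]
    congr 1
    refine sum_congr rfl fun j _ => ?_
    ring
  rw [h2]
  have h3 : y * (y ^ d * Q.eval y) = 0 := by rw [← mul_assoc, ← pow_succ', hy, zero_mul]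
  rw [← h1] at h3
  linear_combination (-4 : R) * h3

section SqrtTaylor

variable (R : Type*) [CommRing R] (d : ℕ)

theorem natDegree_sqrtTaylor_le : (sqrtTaylor R d).natDegree ≤ d := by
  rw [natDegree_le_iff_coeff_eq_zero]
  intro m hm
  have : ∀ j ∈ range d, ¬ m = j + 1 := by intro j hj; rw [mem_range] at hj; omega
  rw [sqrtTaylor, coeff_sub, coeff_one, if_neg (by omega), ← C_ofNat, coeff_C_mul,
    finsetSum_coeff, sum_eq_zero, mul_zero, sub_zero]
  intro j hj
  rw [coeff_C_mul, coeff_X_pow, if_neg (this j hj), mul_zero]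

theorem coeff_sqrtTaylor_succ : (sqrtTaylor R (d + 1)).coeff (d + 1) = -2 * catalan d := by
  rw [sqrtTaylor, coeff_sub, coeff_one, if_neg (by omega), ← C_ofNat, coeff_C_mul,
    finsetSum_coeff, sum_eq_single d]
  · simp
  · intro j _ hj
    rw [coeff_C_mul, coeff_X_pow, if_neg (by omega), mul_zero]
  · simp

end SqrtTaylor

/-! ### Weyl differencing -/

/-- The Weyl–van der Corput differencing inequality, without shortening of the range of shifts. -/
theorem norm_sum_Ico_sq_le_sum_norm_correlation (f : ℤ → ℂ) {A B : ℤ} {V : ℕ} (hV : B - A ≤ V) :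
    ‖∑ v ∈ Ico A B, f v‖ ^ 2 ≤ ∑ h ∈ Ioo (-V : ℤ) V,
      ‖∑ v ∈ Ico (max A (A - h)) (min B (B - h)), f (v + h) * (starRingEnd ℂ) (f v)‖ := by
  have e : (∑ v ∈ Ico A B, f v) * (starRingEnd ℂ) (∑ v ∈ Ico A B, f v) =
      ∑ h ∈ Ioo (-V : ℤ) V,
        ∑ v ∈ Ico (max A (A - h)) (min B (B - h)), f (v + h) * (starRingEnd ℂ) (f v) := by
    rw [map_sum, sum_mul_sum, ← sum_product', sum_sigma']
    refine sum_nbij' (fun x => ⟨x.1 - x.2, x.2⟩) (fun y => (y.2 + y.1, y.2)) ?_ ?_ ?_ ?_ ?_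
    · rintro ⟨u, v⟩ h
      simp only [mem_product, mem_Ico, mem_sigma, mem_Ioo] at h ⊢
      omega
    · rintro ⟨u, v⟩ h
      simp only [mem_product, mem_Ico, mem_sigma, mem_Ioo] at h ⊢
      omega
    · rintro ⟨u, v⟩ _
      simp
    · rintro ⟨u, v⟩ _
      simp
    · rintro ⟨u, v⟩ _
      simp
  rw [sq]
  nth_rewrite 2 [← RCLike.norm_conj]
  rw [← norm_mul, e]
  exact norm_sum_le _ _

/-- Complete periods do not contribute to a geometric sum of a root of unity. -/
theorem norm_geom_sum_le_of_pow_eq_one {ζ : ℂ} {M : ℕ} (hM : 0 < M) (h1 : ζ ^ M = 1) (hζ : ζ ≠ 1)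
    (N : ℕ) : ‖∑ j ∈ range N, ζ ^ j‖ ≤ M := by
  have hn : ‖ζ‖ = 1 := Complex.norm_eq_one_of_pow_eq_one h1 hM.ne'
  have e : ∑ j ∈ range N, ζ ^ j = ∑ j ∈ range (N % M), ζ ^ j := by
    rw [geom_sum_eq hζ, geom_sum_eq hζ]
    nth_rewrite 1 [← Nat.div_add_mod N M]
    rw [pow_add, pow_mul, h1, one_pow, one_mul]
  rw [e]
  refine (norm_sum_le_of_le _ (n := fun _ => 1) fun j _ => ?_).trans ?_
  · rw [norm_pow, hn, one_pow]
  · simpa using (Nat.mod_lt N hM).le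

theorem norm_sum_Ico_le {f : ℤ → ℂ} (hf : ∀ v, ‖f v‖ ≤ 1) {A B : ℤ} {V : ℕ} (hV : B - A ≤ V) :
    ‖∑ v ∈ Ico A B, f v‖ ≤ V := by
  refine (norm_sum_le_of_le _ (n := fun _ => 1) fun j _ => hf j).trans ?_
  simp only [sum_const, Int.card_Ico, nsmul_eq_mul, mul_one]
  have : (B - A).toNat ≤ V := by omega
  exact_mod_cast this

theorem card_Ioo_filter_dvd_le (V : ℕ) {r : ℕ} (hr : 0 < r) :
    ((#{h ∈ Ioo (-V : ℤ) V | (r : ℤ) ∣ h} : ℕ) : ℝ) ≤ 2 * V / r + 1 := by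
  have h1 : #{h ∈ Ioo (-V : ℤ) V | (r : ℤ) ∣ h} ≤ #{h ∈ Ioc (-V : ℤ) V | (r : ℤ) ∣ h} :=
    card_le_card (filter_subset_filter _ Ioo_subset_Ioc_self)
  have h2 := Int.Ioc_filter_dvd_card (-V : ℤ) V (r := r) (by exact_mod_cast hr)
  have h3 : ((⌊((V : ℤ) : ℚ) / ((r : ℤ) : ℚ)⌋ - ⌊((-V : ℤ) : ℚ) / ((r : ℤ) : ℚ)⌋ : ℤ) : ℚ) ≤
      2 * V / r + 1 := by
    have a1 := Int.floor_le (((V : ℤ) : ℚ) / ((r : ℤ) : ℚ))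
    have a2 := Int.lt_floor_add_one (((-V : ℤ) : ℚ) / ((r : ℤ) : ℚ))
    push_cast at a1 a2 ⊢
    have : (-(V : ℚ)) / r = - (V / r) := neg_div _ _
    rw [this] at a2 ⊢
    rw [show (2 * V / r : ℚ) = V / r + V / r by ring]
    linarith
  have h4 : (((#{h ∈ Ioc (-V : ℤ) V | (r : ℤ) ∣ h} : ℕ) : ℤ) : ℚ) ≤ 2 * V / r + 1 := by
    rw [h2]
    push_cast at h3 ⊢
    exact max_le h3 (by positivity)
  have h5 : ((#{h ∈ Ioc (-V : ℤ) V | (r : ℤ) ∣ h} : ℕ) : ℝ) ≤ 2 * V / r + 1 := by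
    have := (Rat.cast_le (K := ℝ)).2 h4
    push_cast at this ⊢
    exact this
  exact le_trans (by exact_mod_cast h1) h5

section Differencing

variable {R : Type*} [CommRing R]

theorem natDegree_taylor_sub_le (h : R) {P : R[X]} {d : ℕ} (hP : P.natDegree ≤ d + 1) :
    (taylor h P - P).natDegree ≤ d := by
  rw [natDegree_le_iff_coeff_eq_zero]
  intro m hm
  rw [coeff_sub, taylor_coeff]
  have hd : (hasseDeriv m P).natDegree = 0 := by
    have := natDegree_hasseDeriv_le P m
    omega
  rw [eq_C_of_natDegree_eq_zero hd, eval_C, hasseDeriv_coeff]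
  simp

theorem coeff_taylor_sub (h : R) {P : R[X]} {d : ℕ} (hP : P.natDegree ≤ d + 1) :
    (taylor h P - P).coeff d = (d + 1 : ℕ) * h * P.coeff (d + 1) := by
  have hd : (hasseDeriv d P).natDegree ≤ 1 := by
    have := natDegree_hasseDeriv_le P d
    omega
  rw [coeff_sub, taylor_coeff, eq_X_add_C_of_natDegree_le_one hd]
  simp only [hasseDeriv_coeff, eval_add, eval_mul, eval_C, eval_X, zero_add, Nat.choose_self,
    add_comm 1 d, Nat.choose_succ_self_right]
  push_cast
  ring

end Differencing

/-- Multiplication by an integer of valuation at most `i` raises the valuation of `c` by at most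
`i`. -/
theorem ZMod.pow_mul_ne_zero_of_not_dvd {p n : ℕ} [Fact p.Prime] {c : ZMod (p ^ n)} {i j : ℕ}
    (hc : (p : ZMod (p ^ n)) ^ (j + i) * c ≠ 0) {h : ℤ} (hh : ¬ (p : ℤ) ^ (i + 1) ∣ h) :
    (p : ZMod (p ^ n)) ^ j * (h * c) ≠ 0 := by
  have hp : p.Prime := Fact.out
  have hpi : Prime (p : ℤ) := Nat.prime_iff_prime_int.1 hp
  intro h0
  apply hc
  obtain ⟨c', rfl⟩ : ∃ c' : ℤ, (c' : ZMod (p ^ n)) = c := ⟨_, ZMod.intCast_zmod_cast c⟩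
  have h1 : ((p ^ n : ℕ) : ℤ) ∣ p ^ j * (h * c') := by
    rw [← ZMod.intCast_zmod_eq_zero_iff_dvd]
    exact_mod_cast h0
  have h2 : ((p ^ n : ℕ) : ℤ) ∣ p ^ (j + i) * c' := by
    push_cast at h1 ⊢
    have hh0 : h ≠ 0 := by rintro rfl; exact hh (dvd_zero _)
    obtain ⟨r, m, hm, rfl⟩ : ∃ r : ℕ, ∃ m : ℤ, ¬ (p : ℤ) ∣ m ∧ h = p ^ r * m := by
      obtain ⟨m, hm, hm'⟩ :=
        (FiniteMultiplicity.of_prime_left hpi hh0).exists_eq_pow_mul_and_not_dvd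
      exact ⟨_, m, hm', hm⟩
    have hr : r ≤ i := by
      by_contra hri
      exact hh (Dvd.dvd.mul_right (pow_dvd_pow _ (by omega)) _)
    have hcop : IsCoprime ((p : ℤ) ^ n) m :=
      ((Prime.coprime_iff_not_dvd hpi).2 hm).pow_left
    have h3 : (p : ℤ) ^ n ∣ m * (p ^ (j + r) * c') := by
      convert h1 using 1
      ring
    have h4 := hcop.dvd_of_dvd_mul_left h3
    refine h4.trans (mul_dvd_mul_right (pow_dvd_pow _ (by omega)) _)
  rw [← ZMod.intCast_zmod_eq_zero_iff_dvd] at h2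
  exact_mod_cast h2

/-- Weyl's inequality for a polynomial of degree `d + 1` modulo `p ^ n`. With
`c = (d + 1)! * P.coeff (d + 1)`, the conditions on `P` say that the valuation of `c` is at least
`n - k` and less than `n - d i`. Each of the `d` differencing steps multiplies `c` by the shift `h`.
The shifts divisible by `p ^ (i + 1)`, of which there are few, are estimated trivially, and for
the others the valuation grows by at most `i`, so that the linear sum at the end is a geometric sum
of ratio different from `1` and of period dividing `p ^ k`. -/
theorem norm_weylSum_le {p n : ℕ} [Fact p.Prime] {k i V : ℕ} {ε : ℝ} (hε1 : ε ≤ 1) (hV : 0 < V)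
    (hk : (p : ℝ) ^ k ≤ ε * V) (hi : 1 ≤ ε * p ^ (i + 1)) (hVε : 1 ≤ ε * V) (d : ℕ) :
    ∀ P : (ZMod (p ^ n))[X], P.natDegree ≤ d + 1 →
      (p : ZMod (p ^ n)) ^ k * ((d + 1).factorial * P.coeff (d + 1)) = 0 →
      (p : ZMod (p ^ n)) ^ (d * i) * ((d + 1).factorial * P.coeff (d + 1)) ≠ 0 →
      ∀ A B : ℤ, B - A ≤ V →
        ‖∑ v ∈ Ico A B, ZMod.stdAddChar (P.eval (v : ZMod (p ^ n)))‖ ≤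
          5 * V * ε ^ ((1 / 2 : ℝ) ^ d) := by
  have hp : p.Prime := Fact.out
  have hV' : (0 : ℝ) < V := by exact_mod_cast hV
  have hε0 : 0 < ε := by
    by_contra h
    have := mul_nonpos_of_nonpos_of_nonneg (not_lt.1 h) hV'.le
    linarith
  induction d with
  | zero =>
    intro P hP h1 h2 A B hAB
    simp only [zero_add, Nat.factorial_one, Nat.cast_one, one_mul, zero_mul, pow_zero,
      Real.rpow_one] at *
    have e : ∑ v ∈ Ico A B, ZMod.stdAddChar (P.eval (v : ZMod (p ^ n))) =
        ZMod.stdAddChar (P.coeff 1 * (A : ZMod (p ^ n)) + P.coeff 0) *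
          ∑ j ∈ range (B - A).toNat, ZMod.stdAddChar (P.coeff 1) ^ j := by
      rw [mul_sum]
      refine sum_nbij' (fun v => (v - A).toNat) (fun j => A + j) ?_ ?_ ?_ ?_ ?_
      · intro v hv; simp only [mem_Ico, mem_range] at *; omega
      · intro v hv; simp only [mem_Ico, mem_range] at *; omega
      · intro v hv; simp only [mem_Ico] at *; omega
      · intro v hv; simp
      · intro v hv
        rw [mem_Ico] at hv
        rw [← AddChar.map_nsmul_eq_pow, ← AddChar.map_add_eq_mul]
        congr 1
        obtain ⟨j, rfl⟩ : ∃ j : ℕ, v = A + j := ⟨(v - A).toNat, by omega⟩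
        nth_rewrite 1 [eq_X_add_C_of_natDegree_le_one hP]
        simp
        ring
    rw [e, norm_mul, AddChar.norm_apply, one_mul]
    have hz : ZMod.stdAddChar (P.coeff 1) ^ p ^ k = (1 : ℂ) := by
      rw [← AddChar.map_nsmul_eq_pow, nsmul_eq_mul]
      push_cast
      rw [h1, AddChar.map_zero_eq_one]
    have hz1 : ZMod.stdAddChar (P.coeff 1) ≠ (1 : ℂ) := by
      intro h
      apply h2
      apply ZMod.injective_stdAddChar
      rw [h, AddChar.map_zero_eq_one]
    refine (norm_geom_sum_le_of_pow_eq_one (pow_pos hp.pos k) hz hz1 _).trans ?_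
    push_cast
    nlinarith
  | succ d ih =>
    intro P hP h1 h2 A B hAB
    set E : ℝ := ε ^ ((1 / 2 : ℝ) ^ d) with hE
    have hE0 : 0 < E := Real.rpow_pos_of_pos hε0 _
    have hεE : ε ≤ E := by
      conv_lhs => rw [← Real.rpow_one ε]
      exact Real.rpow_le_rpow_of_exponent_ge hε0 hε1 (pow_le_one₀ (by norm_num) (by norm_num))
    have hsq : (ε ^ ((1 / 2 : ℝ) ^ (d + 1))) ^ 2 = E := by
      rw [hE, ← Real.rpow_natCast, ← Real.rpow_mul hε0.le, pow_succ]
      congr 1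
      push_cast
      ring
    have hdiff := norm_sum_Ico_sq_le_sum_norm_correlation
      (fun v : ℤ => ZMod.stdAddChar (P.eval (v : ZMod (p ^ n)))) hAB
    have hterm : ∀ h : ℤ, ∀ v : ℤ, ZMod.stdAddChar (P.eval ((v + h : ℤ) : ZMod (p ^ n))) *
        (starRingEnd ℂ) (ZMod.stdAddChar (P.eval (v : ZMod (p ^ n)))) =
        ZMod.stdAddChar ((taylor (h : ZMod (p ^ n)) P - P).eval (v : ZMod (p ^ n))) := by
      intro h v
      rw [← AddChar.map_neg_eq_conj, ← AddChar.map_add_eq_mul, eval_sub, taylor_eval,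
        sub_eq_add_neg]
      push_cast
      rfl
    simp only [hterm] at hdiff
    have hbound : ∀ h ∈ Ioo (-V : ℤ) V,
        ‖∑ v ∈ Ico (max A (A - h)) (min B (B - h)),
          ZMod.stdAddChar ((taylor (h : ZMod (p ^ n)) P - P).eval (v : ZMod (p ^ n)))‖ ≤
        5 * V * E + if ((p ^ (i + 1) : ℕ) : ℤ) ∣ h then (V : ℝ) else 0 := by
      intro h _
      have hlen : min B (B - h) - max A (A - h) ≤ V := by omega
      split_ifs with hh
      · have := norm_sum_Ico_le (f := fun v : ℤ => ZMod.stdAddChar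
          ((taylor (h : ZMod (p ^ n)) P - P).eval (v : ZMod (p ^ n))))
          (fun v => (AddChar.norm_apply _ _).le) hlen
        have h0 : 0 ≤ 5 * V * E := by positivity
        linarith
      · rw [add_zero]
        have hc : ((d + 1).factorial : ZMod (p ^ n)) *
            (taylor (h : ZMod (p ^ n)) P - P).coeff (d + 1) =
            h * ((d + 1 + 1).factorial * P.coeff (d + 1 + 1)) := by
          rw [coeff_taylor_sub _ hP, Nat.factorial_succ (d + 1)]
          push_cast
          ring
        refine ih _ (natDegree_taylor_sub_le _ hP) ?_ ?_ _ _ hlen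
        · rw [hc, mul_left_comm, h1, mul_zero]
        · rw [hc]
          refine ZMod.pow_mul_ne_zero_of_not_dvd (i := i) ?_ (by exact_mod_cast hh)
          rwa [← Nat.succ_mul]
    have hcount := card_Ioo_filter_dvd_le V (pow_pos hp.pos (i + 1))
    have hcard : ((#(Ioo (-V : ℤ) V) : ℕ) : ℝ) ≤ 2 * V := by
      rw [Int.card_Ioo]
      have : ((V : ℤ) - -V - 1).toNat ≤ 2 * V := by omega
      exact_mod_cast this
    have htotal : ‖∑ v ∈ Ico A B, ZMod.stdAddChar (P.eval (v : ZMod (p ^ n)))‖ ^ 2 ≤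
        (5 * V * ε ^ ((1 / 2 : ℝ) ^ (d + 1))) ^ 2 := by
      rw [mul_pow, hsq]
      refine hdiff.trans ((sum_le_sum hbound).trans ?_)
      rw [sum_add_distrib, ← sum_filter, sum_const, sum_const, nsmul_eq_mul, nsmul_eq_mul]
      have hpi : (0 : ℝ) < (p : ℝ) ^ (i + 1) := by have := hp.pos; positivity
      have h3 : 2 * V / ((p ^ (i + 1) : ℕ) : ℝ) + 1 ≤ 3 * V * ε := by
        push_cast
        have : 2 * V / (p : ℝ) ^ (i + 1) ≤ 2 * V * ε := by
          rw [div_le_iff₀ hpi]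
          nlinarith
        linarith
      have h4 := hcount.trans h3
      calc _ ≤ 2 * V * (5 * V * E) + 3 * V * ε * V := by gcongr
        _ ≤ 2 * V * (5 * V * E) + 3 * V * E * V := by gcongr
        _ ≤ (5 * V) ^ 2 * E := by nlinarith [mul_pos (mul_pos hV' hV') hE0]
    exact le_of_sq_le_sq htotal (by positivity)

/-! ### Stationary phase for Kloosterman sums -/

theorem IsLocalRing.isUnit_add_of_not_isUnit {R : Type*} [CommRing R] [IsLocalRing R] {x y : R}
    (hx : IsUnit x) (hy : ¬ IsUnit y) : IsUnit (x + y) := by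
  have : IsUnit ((x + y) + -y) := by simpa using hx
  rcases IsLocalRing.isUnit_or_isUnit_of_isUnit_add this with h | h
  · exact h
  · exact absurd (by simpa using h) hy

section StationaryPhase

variable {R : Type*} [CommRing R] [Fintype R] [DecidableEq R] {ψ : AddChar R ℂ}

/-- Stationary phase: as `π² = 0`, replacing `x` by `x (1 + π t)` multiplies the summand by the
character `t ↦ ψ (t π (u x - b x⁻¹))`, whose average over `t` vanishes unless
`π (u x - b x⁻¹) = 0`. -/
theorem sum_units_eq_sum_stationary (hψ : ψ.IsPrimitive) {π : R} (hπ : π * π = 0) (u b : R) :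
    ∑ x : Rˣ, ψ (u * x + b * (x⁻¹ : Rˣ)) =
      ∑ x : Rˣ with π * (u * x - b * (x⁻¹ : Rˣ)) = 0, ψ (u * x + b * (x⁻¹ : Rˣ)) := by
  have hshift : ∀ t : R, ∑ x : Rˣ, ψ (u * x + b * (x⁻¹ : Rˣ)) =
      ∑ x : Rˣ, ψ (u * x + b * (x⁻¹ : Rˣ)) * ψ (t * (π * (u * x - b * (x⁻¹ : Rˣ)))) := by
    intro t
    let s : Rˣ := ⟨1 + π * t, 1 - π * t, by linear_combination (-t ^ 2) * hπ,
      by linear_combination (-t ^ 2) * hπ⟩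
    rw [← Equiv.sum_comp (Equiv.mulRight s)]
    refine sum_congr rfl fun x _ => ?_
    rw [← AddChar.map_add_eq_mul]
    congr 1
    have h1 : ((x * s : Rˣ) : R) = x * (1 + π * t) := rfl
    have h2 : (((x * s)⁻¹ : Rˣ) : R) = (1 - π * t) * (x⁻¹ : Rˣ) := by
      rw [mul_inv_rev]; rfl
    rw [Equiv.coe_mulRight, h1, h2]
    ring
  have hsum : (Fintype.card R : ℂ) * ∑ x : Rˣ, ψ (u * x + b * (x⁻¹ : Rˣ)) =
      (Fintype.card R : ℂ) *
        ∑ x : Rˣ with π * (u * x - b * (x⁻¹ : Rˣ)) = 0, ψ (u * x + b * (x⁻¹ : Rˣ)) := by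
    calc _ = ∑ _t : R, ∑ x : Rˣ, ψ (u * x + b * (x⁻¹ : Rˣ)) := by simp
      _ = ∑ t : R, ∑ x : Rˣ,
          ψ (u * x + b * (x⁻¹ : Rˣ)) * ψ (t * (π * (u * x - b * (x⁻¹ : Rˣ)))) :=
        sum_congr rfl fun t _ => hshift t
      _ = _ := by
        rw [sum_comm, sum_filter, mul_sum]
        refine sum_congr rfl fun x _ => ?_
        rw [← mul_sum, AddChar.sum_mulShift _ hψ]
        split_ifs <;> simp [mul_comm]
  have hcard : (Fintype.card R : ℂ) ≠ 0 := by exact_mod_cast Fintype.card_ne_zero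
  exact mul_left_cancel₀ hcard hsum

/-- When the first parameter varies by the square of a unit `τ`, the stationary points can be
chosen independent of `τ`, and the phase is linear in `τ`. -/
theorem sum_units_mul_sq_eq_sum_stationary (hψ : ψ.IsPrimitive) {π : R} (hπ : π * π = 0) (u b : R)
    (τ : Rˣ) :
    ∑ x : Rˣ, ψ (u * τ ^ 2 * x + b * (x⁻¹ : Rˣ)) =
      ∑ z : Rˣ with π * (u * z - b * (z⁻¹ : Rˣ)) = 0, ψ ((u * z + b * (z⁻¹ : Rˣ)) * τ) := by
  have h := sum_units_eq_sum_stationary hψ hπ (u * τ) (b * τ)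
  have h1 : ∑ x : Rˣ, ψ (u * τ ^ 2 * x + b * (x⁻¹ : Rˣ)) =
      ∑ x : Rˣ, ψ (u * τ * x + b * τ * (x⁻¹ : Rˣ)) := by
    rw [← Equiv.sum_comp (Equiv.mulRight τ⁻¹)]
    refine sum_congr rfl fun x _ => ?_
    congr 1
    rw [Equiv.coe_mulRight, mul_inv_rev, inv_inv, Units.val_mul, Units.val_mul]
    linear_combination (u * τ * x) * τ.mul_inv
  rw [h1, h]
  have h2 : ∀ z : Rˣ, π * (u * τ * z - b * τ * (z⁻¹ : Rˣ)) = 0 ↔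
      π * (u * z - b * (z⁻¹ : Rˣ)) = 0 := by
    intro z
    rw [show π * (u * τ * z - b * τ * (z⁻¹ : Rˣ)) = π * (u * z - b * (z⁻¹ : Rˣ)) * τ by ring,
      Units.mul_left_eq_zero]
  simp only [h2]
  refine sum_congr rfl fun z _ => ?_
  congr 1
  ring

variable [IsLocalRing R]

/-- Two stationary points `x`, `z` satisfy `π (x - z) (x + z) = 0`, and one of the two factors is a
unit because their sum `2 x` is. -/
theorem card_stationary_le (h2 : IsUnit (2 : R)) (π : R) {u : R} (hu : IsUnit u) (b : R) :
    #{x : Rˣ | π * (u * x - b * (x⁻¹ : Rˣ)) = 0} ≤ 2 * #{y : R | π * y = 0} := by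
  rcases Finset.eq_empty_or_nonempty {x : Rˣ | π * (u * x - b * (x⁻¹ : Rˣ)) = 0} with h | ⟨z, hz⟩
  · rw [h]; simp
  rw [mem_filter] at hz
  have hsq : ∀ x : Rˣ, π * (u * x - b * (x⁻¹ : Rˣ)) = 0 → π * (u * x ^ 2) = π * b := by
    intro x hx
    linear_combination (x : R) * hx + π * b * x.mul_inv
  have hsub : ({x : Rˣ | π * (u * x - b * (x⁻¹ : Rˣ)) = 0} : Finset Rˣ).map
      ⟨Units.val, Units.val_injective⟩ ⊆
      ({y : R | π * y = 0} : Finset R).image (fun y => y + z) ∪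
        ({y : R | π * y = 0} : Finset R).image (fun y => y - z) := by
    intro y hy
    simp only [mem_map, mem_filter, mem_univ, true_and, Function.Embedding.coeFn_mk] at hy
    obtain ⟨x, hx, rfl⟩ := hy
    have h0 : u * (π * ((x - z) * (x + z))) = 0 := by
      linear_combination hsq x hx - hsq z hz.2
    rw [hu.mul_right_eq_zero] at h0
    have hxz : IsUnit (((x : R) - z) + (x + z)) := by
      rw [show ((x : R) - z) + (x + z) = 2 * x by ring]
      exact h2.mul x.isUnit
    simp only [mem_union, mem_image, mem_filter, mem_univ, true_and]
    rcases IsLocalRing.isUnit_or_isUnit_of_isUnit_add hxz with h | h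
    · right
      refine ⟨x + z, ?_, by ring⟩
      rwa [mul_left_comm, h.mul_right_eq_zero] at h0
    · left
      refine ⟨x - z, ?_, by ring⟩
      rwa [← mul_assoc, h.mul_left_eq_zero] at h0
  calc _ = _ := (card_map _).symm
    _ ≤ _ := card_le_card hsub
    _ ≤ _ := card_union_le _ _
    _ ≤ _ := by
      rw [two_mul]
      exact Nat.add_le_add card_image_le card_image_le

end StationaryPhase

/-! ### Kloosterman sums along a progression of frequencies -/

theorem ZMod.isLocalRing_prime_pow (p : ℕ) [Fact p.Prime] {n : ℕ} (hn : n ≠ 0) :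
    IsLocalRing (ZMod (p ^ n)) := by
  have hp : p.Prime := Fact.out
  have : Fact (1 < p ^ n) := ⟨Nat.one_lt_pow hn hp.one_lt⟩
  exact IsLocalRing.of_surjective' (PadicInt.toZModPow n) (ZMod.ringHom_surjective _)

theorem ZMod.not_isUnit_of_pow_mul_eq_zero {p n m : ℕ} [Fact p.Prime] (hmn : m < n)
    {y : ZMod (p ^ n)} (hy : (p : ZMod (p ^ n)) ^ m * y = 0) : ¬ IsUnit y := by
  intro h
  rw [h.mul_left_eq_zero, ← Nat.cast_pow, ZMod.natCast_eq_zero_iff] at hy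
  exact absurd ((Nat.pow_dvd_pow_iff_le_right (Fact.out : p.Prime).one_lt).1 hy) (by omega)

theorem ZMod.natCast_pow_eq_zero {p n k : ℕ} (h : n ≤ k) : (p : ZMod (p ^ n)) ^ k = 0 := by
  rw [← Nat.cast_pow, ZMod.natCast_eq_zero_iff]
  exact pow_dvd_pow p h

theorem ZMod.pow_mul_natCast_ne_zero {p n a N : ℕ} [Fact p.Prime] (hN : 0 < N) (h : a + N ≤ n) :
    (p : ZMod (p ^ n)) ^ a * (N : ZMod (p ^ n)) ≠ 0 := by
  have hp : p.Prime := Fact.out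
  rw [← Nat.cast_pow, ← Nat.cast_mul, Ne, ZMod.natCast_eq_zero_iff]
  intro hd
  have h1 : p ^ a * p ^ N ∣ p ^ a * N := by
    rw [← pow_add]
    exact (pow_dvd_pow p h).trans hd
  have h2 := Nat.le_of_dvd hN (Nat.dvd_of_mul_dvd_mul_left (pow_pos hp.pos a) h1)
  exact absurd (Nat.lt_pow_self hp.one_lt (n := N)) (by omega)

theorem ZMod.card_pow_mul_eq_zero_le {p n : ℕ} [Fact p.Prime] (m : ℕ) :
    #{y : ZMod (p ^ n) | (p : ZMod (p ^ n)) ^ m * y = 0} ≤ p ^ m := by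
  have := IsAddCyclic.card_nsmul_eq_zero_le (α := ZMod (p ^ n)) (n := p ^ m)
    (pow_pos (Fact.out : p.Prime).pos m)
  simpa [nsmul_eq_mul] using this

/-- Cancellation between the Kloosterman sums with first parameters `u + p ^ w * v`. The degree of
the polynomial phase is `d + 2`, so that the linear twist `c * v` does not affect the leading
coefficient. -/
theorem norm_sum_shifted_kloosterman_le {p n : ℕ} [Fact p.Prime] (hp2 : p ≠ 2)
    {d w m k i V : ℕ} {ε : ℝ} (hm : n ≤ 2 * m) (hmn : m < n) (hw : 0 < w) (hwd : n ≤ w * (d + 3))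
    (hkn : n ≤ k + w * (d + 2))
    (hlow : (d + 1) * i + w * (d + 2) + (d + 2).factorial * catalan (d + 1) ≤ n)
    (hε1 : ε ≤ 1) (hV : 0 < V) (hk : (p : ℝ) ^ k ≤ ε * V) (hi : 1 ≤ ε * p ^ (i + 1))
    (hVε : 1 ≤ ε * V) (u c : ZMod (p ^ n)) (b : (ZMod (p ^ n))ˣ) :
    ‖∑ v ∈ range V, ZMod.stdAddChar (N := p ^ n) (c * v) * ∑ x : (ZMod (p ^ n))ˣ,
      ZMod.stdAddChar (N := p ^ n)
        ((u + (p : ZMod (p ^ n)) ^ w * v) * x + b * (x⁻¹ : (ZMod (p ^ n))ˣ))‖ ≤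
      2 * p ^ m * (5 * V * ε ^ ((1 / 2 : ℝ) ^ (d + 1))) := by
  have hp : p.Prime := Fact.out
  have : IsLocalRing (ZMod (p ^ n)) := ZMod.isLocalRing_prime_pow p (by omega)
  have hψ := ZMod.isPrimitive_stdAddChar (p ^ n)
  set π : ZMod (p ^ n) := (p : ZMod (p ^ n)) ^ m with hπdef
  have hπ : π * π = 0 := by rw [hπdef, ← pow_add]; exact ZMod.natCast_pow_eq_zero (by omega)
  have hε0 : 0 < ε := by
    by_contra h
    have := mul_nonpos_of_nonpos_of_nonneg (not_lt.1 h) (Nat.cast_nonneg (α := ℝ) V)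
    linarith
  have hpw : ∀ y : ZMod (p ^ n), ¬ IsUnit ((p : ZMod (p ^ n)) ^ w * y) := by
    intro y
    refine ZMod.not_isUnit_of_pow_mul_eq_zero (m := n - 1) (by omega) ?_
    rw [← mul_assoc, ← pow_add, ZMod.natCast_pow_eq_zero (by omega), zero_mul]
  have h2 : IsUnit (2 : ZMod (p ^ n)) := by
    have := (ZMod.isUnit_iff_coprime 2 (p ^ n)).2
      (((Nat.coprime_primes Nat.prime_two hp).2 hp2.symm).pow_right n)
    exact_mod_cast this
  by_cases hu : IsUnit u
  · obtain ⟨u, rfl⟩ := hu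
    obtain ⟨f, hf⟩ : ∃ f : (ZMod (p ^ n))ˣ, (f : ZMod (p ^ n)) = 4 :=
      ⟨(h2.mul h2).unit, by rw [IsUnit.unit_spec]; norm_num⟩
    -- `β = -p ^ w / (4 u)`, so that `u (1 - 4 β v) = u + p ^ w v`.
    set β : ZMod (p ^ n) := -((f⁻¹ : (ZMod (p ^ n))ˣ) * (u⁻¹ : (ZMod (p ^ n))ˣ)) * p ^ w with hβ
    have hβ4 : u * (1 - 4 * β) = u + p ^ w := by
      rw [hβ, ← hf]
      linear_combination (u * (u⁻¹ : (ZMod (p ^ n))ˣ) * p ^ w) * f.mul_inv +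
        (p : ZMod (p ^ n)) ^ w * u.mul_inv
    have hβ4' : ∀ v : ZMod (p ^ n), u * (1 - 4 * (β * v)) = u + p ^ w * v := by
      intro v
      linear_combination v * hβ4
    set T := sqrtTaylor (ZMod (p ^ n)) (d + 2)
    have hT : ∀ v : ZMod (p ^ n), u * T.eval (β * v) ^ 2 = u + p ^ w * v := by
      intro v
      rw [sqrtTaylor_eval_sq, hβ4']
      rw [hβ, mul_pow, mul_pow, ← pow_mul, ZMod.natCast_pow_eq_zero hwd]
      ring
    have hTu : ∀ v : ZMod (p ^ n), IsUnit (T.eval (β * v)) := by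
      intro v
      have h1 : IsUnit (u * T.eval (β * v) ^ 2) := by
        rw [hT]
        exact IsLocalRing.isUnit_add_of_not_isUnit u.isUnit (hpw v)
      exact (isUnit_pow_iff two_ne_zero).1 (isUnit_of_mul_isUnit_right h1)
    -- The stationary points for `u`, which serve for all `v`.
    set E : Finset (ZMod (p ^ n))ˣ :=
      {z | π * (u * z - b * (z⁻¹ : (ZMod (p ^ n))ˣ)) = 0} with hE
    set κ : (ZMod (p ^ n))ˣ → ZMod (p ^ n) :=
      fun z => u * z + b * (z⁻¹ : (ZMod (p ^ n))ˣ) with hκ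
    have hκu : ∀ z ∈ E, IsUnit (κ z) := by
      intro z hz
      rw [hE, mem_filter] at hz
      have h1 := ZMod.not_isUnit_of_pow_mul_eq_zero hmn hz.2
      have h3 := IsLocalRing.isUnit_add_of_not_isUnit
        ((h2.mul b.isUnit).mul (z⁻¹).isUnit) h1
      convert h3 using 1
      simp only [hκ]
      ring
    have hexp : ∀ v : ℕ, ∑ x : (ZMod (p ^ n))ˣ,
        ZMod.stdAddChar (N := p ^ n)
          ((u + (p : ZMod (p ^ n)) ^ w * v) * x + b * (x⁻¹ : (ZMod (p ^ n))ˣ)) =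
        ∑ z ∈ E, ZMod.stdAddChar (κ z * T.eval (β * v)) := by
      intro v
      have h := sum_units_mul_sq_eq_sum_stationary hψ hπ (u : ZMod (p ^ n)) b (hTu v).unit
      rw [IsUnit.unit_spec, hT] at h
      exact h
    set P : (ZMod (p ^ n))ˣ → (ZMod (p ^ n))[X] :=
      fun z => C (κ z) * T.comp (C β * X) + C c * X with hP
    have hcomp : (T.comp (C β * X)).natDegree ≤ d + 2 := by
      rw [natDegree_le_iff_coeff_eq_zero]
      intro j hj
      rw [comp_C_mul_X_coeff,
        coeff_eq_zero_of_natDegree_lt (lt_of_le_of_lt (natDegree_sqrtTaylor_le _ _) hj), zero_mul]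
    have hPdeg : ∀ z, (P z).natDegree ≤ d + 1 + 1 := by
      intro z
      refine natDegree_add_le_of_degree_le ((natDegree_C_mul_le _ _).trans hcomp) ?_
      exact (natDegree_C_mul_le _ _).trans (natDegree_X_le.trans (by omega))
    have hPcoeff : ∀ z, ((d + 1 + 1).factorial : ZMod (p ^ n)) * (P z).coeff (d + 1 + 1) =
        (κ z * -2 * (-((f⁻¹ : (ZMod (p ^ n))ˣ) * (u⁻¹ : (ZMod (p ^ n))ˣ))) ^ (d + 2)) *
          (p ^ (w * (d + 2)) * ((d + 2).factorial * catalan (d + 1) : ℕ)) := by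
      intro z
      rw [hP, coeff_add, coeff_C_mul, comp_C_mul_X_coeff, coeff_sqrtTaylor_succ, coeff_C_mul,
        coeff_X, if_neg (by omega), hβ, mul_pow, ← pow_mul]
      push_cast
      ring
    have hz : ∀ z ∈ E, ‖∑ v ∈ Ico (0 : ℤ) V, ZMod.stdAddChar ((P z).eval (v : ZMod (p ^ n)))‖ ≤
        5 * V * ε ^ ((1 / 2 : ℝ) ^ (d + 1)) := by
      intro z hz
      refine norm_weylSum_le hε1 hV hk hi hVε (d + 1) (P z) (hPdeg z) ?_ ?_ 0 V (by simp)
      · rw [hPcoeff, mul_left_comm, ← mul_assoc (_ ^ k), ← pow_add,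
          ZMod.natCast_pow_eq_zero (by omega), zero_mul, mul_zero]
      · rw [hPcoeff, mul_left_comm, ← mul_assoc (_ ^ _), ← pow_add]
        have hunit : IsUnit
            (κ z * -2 * (-((f⁻¹ : (ZMod (p ^ n))ˣ) * (u⁻¹ : (ZMod (p ^ n))ˣ))) ^ (d + 2)) :=
          ((hκu z hz).mul h2.neg).mul (((f⁻¹).isUnit.mul (u⁻¹).isUnit).neg.pow _)
        rw [Ne, hunit.mul_right_eq_zero]
        refine ZMod.pow_mul_natCast_ne_zero ?_ hlow
        refine Nat.mul_pos (Nat.factorial_pos _) ?_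
        rw [catalan_eq_centralBinom_div]
        exact Nat.div_pos (Nat.le_of_dvd (Nat.centralBinom_pos _)
          (Nat.succ_dvd_centralBinom _)) (Nat.succ_pos _)
    have hswap : ∑ v ∈ range V, ZMod.stdAddChar (N := p ^ n) (c * v) * ∑ x : (ZMod (p ^ n))ˣ,
        ZMod.stdAddChar (N := p ^ n)
          ((u + (p : ZMod (p ^ n)) ^ w * v) * x + b * (x⁻¹ : (ZMod (p ^ n))ˣ)) =
        ∑ z ∈ E, ∑ v ∈ Ico (0 : ℤ) V, ZMod.stdAddChar ((P z).eval (v : ZMod (p ^ n))) := by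
      simp_rw [hexp, mul_sum]
      rw [sum_comm]
      refine sum_congr rfl fun z _ => ?_
      refine sum_nbij' (fun v : ℕ => (v : ℤ)) Int.toNat ?_ ?_ ?_ ?_ ?_
      · intro v hv; simpa using hv
      · intro v hv; simp only [mem_Ico, mem_range] at *; omega
      · intro v _; simp
      · intro v hv; simp only [mem_Ico] at *; omega
      · intro v _
        rw [← AddChar.map_add_eq_mul]
        simp [hP, add_comm]
    rw [hswap]
    refine (norm_sum_le_of_le _ hz).trans ?_
    rw [sum_const, nsmul_eq_mul]
    have hcard : ((#E : ℕ) : ℝ) ≤ 2 * p ^ m := by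
      have := (card_stationary_le h2 π u.isUnit (b : ZMod (p ^ n))).trans
        (Nat.mul_le_mul_left 2 (ZMod.card_pow_mul_eq_zero_le m))
      exact_mod_cast this
    have : 0 ≤ 5 * V * ε ^ ((1 / 2 : ℝ) ^ (d + 1)) := by positivity
    exact mul_le_mul_of_nonneg_right hcard this
  -- If `u` is not a unit, then neither is any `u + p ^ w v`, and there are no stationary points.
  · have hzero : ∀ v : ℕ, ∑ x : (ZMod (p ^ n))ˣ,
        ZMod.stdAddChar (N := p ^ n)
          ((u + (p : ZMod (p ^ n)) ^ w * v) * x + b * (x⁻¹ : (ZMod (p ^ n))ˣ)) = 0 := by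
      intro v
      rw [sum_units_eq_sum_stationary hψ hπ, filter_eq_empty_iff.2, sum_empty]
      intro x _ hx
      refine ZMod.not_isUnit_of_pow_mul_eq_zero hmn hx ?_
      have hnu : ¬ IsUnit ((u + (p : ZMod (p ^ n)) ^ w * v) * x) := by
        rw [Units.isUnit_mul_units]
        exact fun h => (IsLocalRing.isUnit_or_isUnit_of_isUnit_add h).elim hu (hpw _)
      have h3 := IsLocalRing.isUnit_add_of_not_isUnit
        (b.isUnit.mul (x⁻¹).isUnit).neg hnu
      rwa [neg_add_eq_sub] at h3
    simp only [hzero, mul_zero, sum_const_zero, norm_zero]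
    positivity

/-! ### Sums over intervals -/

theorem norm_average_sub_le {V : ℕ} (hV : 0 < V) {f : ℕ → ℂ} {a : ℂ} {r : ℝ}
    (hf : ∀ v < V, ‖f v - a‖ ≤ r) : ‖(V : ℂ)⁻¹ * ∑ v ∈ range V, f v - a‖ ≤ r := by
  have hV' : (V : ℂ) ≠ 0 := by exact_mod_cast hV.ne'
  have hV'' : (0 : ℝ) < V := by exact_mod_cast hV
  have e : (V : ℂ)⁻¹ * ∑ v ∈ range V, f v - a = (V : ℂ)⁻¹ * ∑ v ∈ range V, (f v - a) := by
    rw [sum_sub_distrib, sum_const, card_range, nsmul_eq_mul]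
    field_simp
  rw [e, norm_mul, norm_inv, Complex.norm_natCast, inv_mul_le_iff₀ hV'']
  refine (norm_sum_le_of_le _ (n := fun _ => r) fun v hv => hf v (mem_range.1 hv)).trans ?_
  simp

/-- The summand of the Kloosterman sum, extended by zero to the non-units. -/
noncomputable def kloostermanTerm (q : ℕ) [NeZero q] (a b : ZMod q) (y : ZMod q) : ℂ :=
  open Classical in if IsUnit y then ZMod.stdAddChar (a * y + b * y⁻¹) else 0

theorem norm_kloostermanTerm_le (q : ℕ) [NeZero q] (a b y : ZMod q) :
    ‖kloostermanTerm q a b y‖ ≤ 1 := by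
  rw [kloostermanTerm]
  split_ifs
  · exact (AddChar.norm_apply _ _).le
  · simp

theorem sum_kloostermanTerm_mul (q : ℕ) [NeZero q] (a b : ZMod q) (g : ZMod q → ℂ) :
    ∑ y, kloostermanTerm q a b y * g y =
      ∑ x : (ZMod q)ˣ, ZMod.stdAddChar (a * (x : ZMod q) + b * ((x⁻¹ : (ZMod q)ˣ) : ZMod q)) *
        g x := by
  classical
  have h : ∀ y, kloostermanTerm q a b y * g y =
      if IsUnit y then ZMod.stdAddChar (a * y + b * y⁻¹) * g y else 0 := by
    intro y
    rw [kloostermanTerm]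
    split_ifs <;> simp
  simp_rw [h]
  rw [← sum_filter]
  symm
  refine sum_nbij (fun x : (ZMod q)ˣ => (x : ZMod q)) ?_ ?_ ?_ ?_
  · intro x _; simp
  · intro x _ y _ hxy; exact Units.ext hxy
  · intro y hy
    simp only [coe_filter, mem_univ, true_and, Set.mem_ofPred_eq] at hy
    exact ⟨hy.unit, by simp, rfl⟩
  · intro x _; rw [ZMod.inv_coe_unit]

/-- The bound for an interval of length `N`, in terms of the spacing `p ^ w` and the number `V` of
the frequencies over which the average is taken. -/
theorem norm_sum_kloostermanTerm_le {p n : ℕ} [Fact p.Prime] (hp2 : p ≠ 2)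
    {d w m k i V N : ℕ} {ε : ℝ} (hm : n ≤ 2 * m) (hmn : m < n) (hw : 0 < w)
    (hwd : n ≤ w * (d + 3)) (hkn : n ≤ k + w * (d + 2))
    (hlow : (d + 1) * i + w * (d + 2) + (d + 2).factorial * catalan (d + 1) ≤ n)
    (hε1 : ε ≤ 1) (hV : 0 < V) (hk : (p : ℝ) ^ k ≤ ε * V) (hi : 1 ≤ ε * p ^ (i + 1))
    (hVε : 1 ≤ ε * V) (hN : 4 * Real.pi * (p ^ w * V * N) ≤ (p : ℝ) ^ n)
    (a : ZMod (p ^ n)) (b : (ZMod (p ^ n))ˣ) (A : ZMod (p ^ n)) :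
    ‖∑ j ∈ range N, kloostermanTerm (p ^ n) a b (A + j)‖ ≤
      40 * p ^ m * ε ^ ((1 / 2 : ℝ) ^ (d + 1)) * (2 + Real.log (p ^ n)) := by
  have hp : p.Prime := Fact.out
  have hp1 : (1 : ℝ) ≤ p := by exact_mod_cast hp.one_lt.le
  have hq0 : (0 : ℝ) < (p : ℝ) ^ n := by positivity
  have hV1 : (1 : ℝ) ≤ V := by exact_mod_cast hV
  have hpw1 : (1 : ℝ) ≤ (p : ℝ) ^ w := one_le_pow₀ hp1
  have hpi := Real.pi_gt_three
  -- `θ` bounds the variation of the weight between consecutive integers.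
  set θ : ℝ := 2 * Real.pi * (p ^ w * V) / p ^ n with hθ
  have hθ0 : 0 ≤ θ := by positivity
  have hθN : θ * N ≤ 1 / 2 := by
    rw [hθ, div_mul_eq_mul_div, div_le_iff₀ hq0]
    linarith
  have hNq : N ≤ p ^ n := by
    have h0 : (1 : ℝ) ≤ p ^ w * V := one_le_mul_of_one_le_of_one_le hpw1 hV1
    have h1 : (1 : ℝ) ≤ 4 * Real.pi * (p ^ w * V) := by nlinarith
    have : (N : ℝ) ≤ (p : ℝ) ^ n := by
      refine le_trans ?_ hN
      nlinarith [Nat.cast_nonneg (α := ℝ) N]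
    exact_mod_cast this
  set W : ZMod (p ^ n) → ℂ := fun y =>
    (V : ℂ)⁻¹ * ∑ v ∈ range V, ZMod.stdAddChar (N := p ^ n) (p ^ w * v * (y - A)) with hW
  set B : ℝ := 10 * p ^ m * ε ^ ((1 / 2 : ℝ) ^ (d + 1)) with hB
  have hdft : ∀ h, ‖𝓕 (fun y => kloostermanTerm (p ^ n) a b y * W y) h‖ ≤ B := by
    intro h
    have e : 𝓕 (fun y => kloostermanTerm (p ^ n) a b y * W y) h =
        (V : ℂ)⁻¹ * ∑ v ∈ range V, ZMod.stdAddChar (N := p ^ n) ((-(p ^ w * A)) * v) *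
          ∑ x : (ZMod (p ^ n))ˣ, ZMod.stdAddChar (N := p ^ n)
            (((a - h) + p ^ w * v) * x + b * (x⁻¹ : (ZMod (p ^ n))ˣ)) := by
      rw [ZMod.dft_apply]
      have h1 : ∀ y, ZMod.stdAddChar (-(y * h)) • (kloostermanTerm (p ^ n) a b y * W y) =
          kloostermanTerm (p ^ n) a b y * (ZMod.stdAddChar (-(y * h)) * W y) := by
        intro y; rw [smul_eq_mul]; ring
      simp_rw [h1]
      rw [sum_kloostermanTerm_mul]
      simp only [hW, mul_sum]
      rw [sum_comm]
      refine sum_congr rfl fun v _ => sum_congr rfl fun x _ => ?_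
      rw [mul_left_comm, mul_left_comm (ZMod.stdAddChar _) (V : ℂ)⁻¹, ← AddChar.map_add_eq_mul,
        ← AddChar.map_add_eq_mul, mul_left_comm, ← AddChar.map_add_eq_mul]
      ring_nf
    rw [e, norm_mul, norm_inv, Complex.norm_natCast, inv_mul_le_iff₀ (by positivity)]
    refine (norm_sum_shifted_kloosterman_le hp2 hm hmn hw hwd hkn hlow hε1 hV hk hi hVε
      (a - h) (-(p ^ w * A)) b).trans (le_of_eq ?_)
    rw [hB]; ring
  have hWj : ∀ j : ℕ, W (A + j) =
      (V : ℂ)⁻¹ * ∑ v ∈ range V, ZMod.stdAddChar (((p ^ w * v * j : ℕ) : ℤ) : ZMod (p ^ n)) := by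
    intro j
    simp only [hW]
    congr 1
    refine sum_congr rfl fun v _ => ?_
    congr 1
    push_cast
    ring
  have hsmall : ∀ v < V, ∀ j : ℕ,
      ‖ZMod.stdAddChar (((p ^ w * v * j : ℕ) : ℤ) : ZMod (p ^ n)) - 1‖ ≤ θ * j := by
    intro v hv j
    refine (norm_stdAddChar_intCast_sub_one_le (p ^ n) _).trans ?_
    rw [hθ, div_mul_eq_mul_div]
    push_cast
    rw [abs_of_nonneg (by positivity)]
    have : (v : ℝ) ≤ V := by exact_mod_cast hv.le
    refine div_le_div_of_nonneg_right ?_ hq0.le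
    rw [mul_assoc (2 * Real.pi)]
    gcongr
  have hW1 : ∀ j < N, ‖W (A + j) - 1‖ ≤ 1 / 2 := by
    intro j hj
    rw [hWj]
    refine norm_average_sub_le hV fun v hv => (hsmall v hv j).trans (le_trans ?_ hθN)
    have : (j : ℝ) ≤ N := by exact_mod_cast hj.le
    gcongr
  have hWge : ∀ j < N, 1 / 2 ≤ ‖W (A + j)‖ := by
    intro j hj
    have h1 := norm_sub_norm_le (1 : ℂ) (1 - W (A + j))
    rw [sub_sub_cancel, norm_one, norm_sub_rev] at h1
    linarith [hW1 j hj]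
  have hWne : ∀ j < N, W (A + j) ≠ 0 := by
    intro j hj h
    have := hWge j hj
    rw [h, norm_zero] at this
    linarith
  have hWdiff : ∀ j : ℕ, ‖W (A + (j + 1 : ℕ)) - W (A + j)‖ ≤ θ := by
    intro j
    have e : W (A + (j + 1 : ℕ)) - W (A + j) = (V : ℂ)⁻¹ * ∑ v ∈ range V,
        (ZMod.stdAddChar (((p ^ w * v * j : ℕ) : ℤ) : ZMod (p ^ n)) *
          (ZMod.stdAddChar (((p ^ w * v * 1 : ℕ) : ℤ) : ZMod (p ^ n)) - 1)) - 0 := by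
      rw [hWj, hWj, ← mul_sub, ← sum_sub_distrib, sub_zero]
      congr 1
      refine sum_congr rfl fun v _ => ?_
      rw [mul_sub, ← AddChar.map_add_eq_mul, mul_one, mul_one]
      congr 2
      push_cast
      ring
    rw [e]
    refine norm_average_sub_le hV fun v hv => ?_
    rw [sub_zero, norm_mul, AddChar.norm_apply, one_mul]
    simpa using hsmall v hv 1
  have hsum : ∑ j ∈ range N, kloostermanTerm (p ^ n) a b (A + j) =
      ∑ j ∈ range N, (W (A + j))⁻¹ * (kloostermanTerm (p ^ n) a b (A + j) * W (A + j)) := by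
    refine sum_congr rfl fun j hj => ?_
    have := hWne j (mem_range.1 hj)
    field_simp
  have hlog : (0 : ℝ) ≤ Real.log (p ^ n) := Real.log_nonneg (one_le_pow₀ hp1)
  have hB0 : 0 ≤ B := (norm_nonneg _).trans (hdft 0)
  have habel := norm_sum_mul_le_of_partial_sums (N := N)
    (f := fun j => (W (A + j))⁻¹)
    (g := fun j => kloostermanTerm (p ^ n) a b (A + j) * W (A + j))
    (M := B * (2 + Real.log (p ^ n))) (K := 2) (D := 4 * θ)
    (fun l hl => by
      have := norm_sum_range_le_of_norm_dft_le (p ^ n) hdft A (hl.trans hNq)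
      push_cast at this
      exact this)
    (by norm_num)
    (fun j hj => by
      rw [norm_inv]
      exact inv_le_of_inv_le₀ (by norm_num) (by linarith [hWge j hj]))
    (by positivity)
    (fun j hj => by
      have h0 := hWge j (by omega)
      have h1 := hWge (j + 1) hj
      rw [inv_sub_inv (hWne _ hj) (hWne _ (by omega)), norm_div, norm_mul, norm_sub_rev,
        div_le_iff₀ (by positivity)]
      have h2 : 1 / 2 * (1 / 2) ≤ ‖W (A + (j + 1 : ℕ))‖ * ‖W (A + j)‖ :=
        mul_le_mul h1 h0 (by norm_num) (by positivity)
      have h3 := hWdiff j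
      nlinarith)
  rw [hsum]
  refine habel.trans ?_
  have h4 : 2 + N * (4 * θ) ≤ 4 := by linarith
  calc _ ≤ 4 * (B * (2 + Real.log (p ^ n))) := by gcongr
    _ = _ := by rw [hB]; ring

theorem incompleteKloosterman_eq (p n : ℕ) [Fact p.Prime] (hn : 1 ≤ n) (a b : (ZMod (p ^ n))ˣ)
    (s t : ℝ) :
    incompleteKloosterman p n a b s t = (((p : ℝ) ^ (-((n : ℝ) / 2)) : ℝ) : ℂ) *
      ∑ j ∈ range (⌊t⌋ + 1 - ⌈s⌉).toNat,
        kloostermanTerm (p ^ n) a b ((⌈s⌉ : ZMod (p ^ n)) + j) := by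
  classical
  have hp : p.Prime := Fact.out
  have hunit : ∀ x : ℤ, IsUnit (x : ZMod (p ^ n)) ↔ ¬ (p : ℤ) ∣ x := by
    intro x
    rw [ZMod.coe_int_isUnit_iff_isCoprime, Nat.cast_pow, IsCoprime.pow_left_iff (by omega),
      (Nat.prime_iff_prime_int.1 hp).coprime_iff_not_dvd]
  rw [incompleteKloosterman]
  congr 1
  rw [sum_filter]
  refine sum_nbij' (fun x => (x - ⌈s⌉).toNat) (fun j => ⌈s⌉ + j) ?_ ?_ ?_ ?_ ?_
  · intro x hx; simp only [mem_Icc, mem_range] at *; omega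
  · intro x hx; simp only [mem_Icc, mem_range] at *; omega
  · intro x hx; simp only [mem_Icc] at *; omega
  · intro x hx; simp
  · intro x hx
    rw [mem_Icc] at hx
    obtain ⟨j, rfl⟩ : ∃ j : ℕ, x = ⌈s⌉ + j := ⟨(x - ⌈s⌉).toNat, by omega⟩
    have : (⌈s⌉ + (j : ℤ) - ⌈s⌉).toNat = j := by omega
    rw [this, kloostermanTerm]
    have e : ((⌈s⌉ + (j : ℤ) : ℤ) : ZMod (p ^ n)) = (⌈s⌉ : ZMod (p ^ n)) + j := by push_cast; rfl
    rw [← e]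
    simp only [hunit]

theorem mainTheorem10 (lam : ℝ) (hlam0 : 0 < lam) (hlam1 : lam < 1) :
    ∃ δ : ℝ, 0 < δ ∧ ∀ (p : ℕ) [Fact p.Prime], p ≠ 2 →
      ∃ C : ℝ, 0 < C ∧ ∀ n : ℕ, 1 ≤ n → ∀ (a b : (ZMod (p ^ n))ˣ) (s t : ℝ),
        t - s ≤ (p : ℝ) ^ ((n : ℝ) * (1 - lam)) →
          ‖incompleteKloosterman p n a b s t‖ ≤ C * (p : ℝ) ^ (-((n : ℝ) * δ)) := by
  -- With `D = d + 3`, the parameters are about `w = n / D`, `V = p ^ (2 w)`, `i = n / D²`, so that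
  -- `p ^ (3 w)` is at most about `q ^ (lam / 2)`, and `r` makes room for the rounding errors.
  obtain ⟨d, hd⟩ : ∃ d : ℕ, 6 / lam ≤ d := exists_nat_ge _
  obtain ⟨r, hr⟩ : ∃ r : ℕ, 12 / lam ≤ r := exists_nat_ge _
  set D : ℕ := d + 3 with hD
  have hDpos : (0 : ℝ) < D := by rw [hD]; positivity
  have hDlam : 3 / (D : ℝ) ≤ lam / 2 := by
    rw [div_le_iff₀ hlam0] at hd
    rw [div_le_iff₀ hDpos, hD]
    push_cast
    nlinarith
  set L : ℕ := (d + 2).factorial * catalan (d + 1) with hL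
  set n₀ : ℕ := D * D * (D + L) + r + 2 with hn₀
  set δ : ℝ := 1 / (D ^ 2 * 2 ^ (d + 2)) with hδ
  have hδ0 : 0 < δ := by positivity
  refine ⟨δ, hδ0, fun p _ hp2 => ?_⟩
  have hp : p.Prime := Fact.out
  have hp1 : (1 : ℝ) ≤ p := by exact_mod_cast hp.one_lt.le
  have hp0 : (0 : ℝ) < p := by linarith
  have hp3 : (3 : ℝ) ≤ p := by
    have := hp.two_le
    exact_mod_cast (show 3 ≤ p by omega)
  set C₁ : ℝ := 40 * (p : ℝ) ^ (1 / 2 : ℝ) * (2 + 1 / δ) with hC₁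
  set C₂ : ℝ := 2 * (p : ℝ) ^ (n₀ * (1 + δ) : ℝ) with hC₂
  have hC₁0 : 0 < C₁ := by positivity
  have hC₂0 : 0 < C₂ := by positivity
  refine ⟨C₁ + C₂, by positivity, fun n hn a b s t hst => ?_⟩
  rw [incompleteKloosterman_eq p n hn]
  set N : ℕ := (⌊t⌋ + 1 - ⌈s⌉).toNat with hN
  have hNle : (N : ℝ) ≤ 2 * (p : ℝ) ^ ((n : ℝ) * (1 - lam)) := by
    have h1 : (1 : ℝ) ≤ (p : ℝ) ^ ((n : ℝ) * (1 - lam)) :=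
      Real.one_le_rpow hp1 (mul_nonneg (Nat.cast_nonneg _) (by linarith))
    rcases le_total 0 (⌊t⌋ + 1 - ⌈s⌉) with h | h
    · have h2 : (N : ℝ) = ⌊t⌋ + 1 - ⌈s⌉ := by
        have : (N : ℤ) = ⌊t⌋ + 1 - ⌈s⌉ := by omega
        exact_mod_cast this
      linarith [Int.floor_le t, Int.le_ceil s]
    · have h2 : N = 0 := by omega
      rw [h2, Nat.cast_zero]
      linarith
  rw [norm_mul, Complex.norm_real, Real.norm_of_nonneg (by positivity)]
  have hpδ : 0 < (p : ℝ) ^ (-((n : ℝ) * δ)) := Real.rpow_pos_of_pos hp0 _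
  rcases lt_or_ge n n₀ with hlt | hge
  -- For bounded `n` the trivial bound `N` suffices.
  · have h1 : ‖∑ j ∈ range N, kloostermanTerm (p ^ n) a b ((⌈s⌉ : ZMod (p ^ n)) + j)‖ ≤ N := by
      refine (norm_sum_le_of_le _ (n := fun _ => 1)
        fun j _ => norm_kloostermanTerm_le _ _ _ _).trans (by simp)
    have h2 : (p : ℝ) ^ (-((n : ℝ) / 2)) ≤ 1 :=
      Real.rpow_le_one_of_one_le_of_nonpos hp1 (by
        have := Nat.cast_nonneg (α := ℝ) n
        linarith)
    have hnn : (n : ℝ) ≤ n₀ := by exact_mod_cast hlt.le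
    have h3 : (p : ℝ) ^ ((n : ℝ) * (1 - lam)) ≤
        (p : ℝ) ^ (n₀ * (1 + δ) : ℝ) * (p : ℝ) ^ (-((n : ℝ) * δ)) := by
      rw [← Real.rpow_add hp0]
      refine Real.rpow_le_rpow_of_exponent_le hp1 ?_
      have h4 : (n : ℝ) * (1 + δ) ≤ n₀ * (1 + δ) := by gcongr
      have h5 : 0 ≤ (n : ℝ) * lam := by positivity
      linarith
    calc _ ≤ 1 * (N : ℝ) := mul_le_mul h2 h1 (norm_nonneg _) zero_le_one
      _ ≤ C₂ * (p : ℝ) ^ (-((n : ℝ) * δ)) := by rw [hC₂]; linarith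
      _ ≤ _ := by gcongr; linarith
  -- From here on `n` is large. As `w D ≥ n`, the Taylor polynomial of degree `d + 2` is exact.
  set x : ℕ := n / D with hx
  set i : ℕ := x / D with hi
  set w : ℕ := x + 1 with hw
  have hDpos' : 0 < D := by omega
  have hxn : D * x ≤ n := Nat.mul_div_le n D
  have hxn' : n < D * (x + 1) := Nat.lt_mul_div_succ n hDpos'
  have hix : D * i ≤ x := Nat.mul_div_le x D
  have hix' : x < D * (i + 1) := Nat.lt_mul_div_succ x hDpos'
  have hile : i ≤ x := Nat.div_le_self _ _
  have hibig : D + L ≤ i := by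
    rw [hi, hx, Nat.div_div_eq_div_mul, Nat.le_div_iff_mul_le (by positivity)]
    rw [hn₀] at hge
    linarith [Nat.zero_le r]
  set m : ℕ := (n + 1) / 2 with hm
  set ε : ℝ := ((p : ℝ) ^ (i + 1))⁻¹ with hε
  have hpi0 : (0 : ℝ) < (p : ℝ) ^ (i + 1) := by positivity
  have hpow : ∀ l, i + 1 + l ≤ 2 * w → (p : ℝ) ^ l ≤ ε * (p ^ (2 * w) : ℕ) := by
    intro l hl
    rw [hε, le_inv_mul_iff₀ hpi0, ← pow_add]
    push_cast
    exact pow_le_pow_right₀ hp1 hl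
  have hwreal : 3 + 3 * (w : ℝ) ≤ n * lam := by
    have h1 : (x : ℝ) ≤ n / D := Nat.cast_div_le
    have h2 : (12 : ℝ) ≤ n * lam := by
      rw [div_le_iff₀ hlam0] at hr
      have : (r : ℝ) ≤ n := by exact_mod_cast (show r ≤ n by omega)
      nlinarith
    have h3 : 3 * ((n : ℝ) / D) ≤ n * lam / 2 := by
      have := mul_le_mul_of_nonneg_left hDlam (Nat.cast_nonneg (α := ℝ) n)
      calc 3 * ((n : ℝ) / D) = n * (3 / D) := by ring
        _ ≤ n * (lam / 2) := this
        _ = _ := by ring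
    rw [hw]
    push_cast
    linarith
  have hNsmall : 4 * Real.pi * (p ^ w * (p ^ (2 * w) : ℕ) * N) ≤ (p : ℝ) ^ n := by
    have h27 : 8 * Real.pi ≤ (p : ℝ) ^ (3 : ℝ) := by
      have h1 : (3 : ℝ) ^ (3 : ℕ) ≤ (p : ℝ) ^ (3 : ℕ) := pow_le_pow_left₀ (by norm_num) hp3 3
      have h2 : (p : ℝ) ^ (3 : ℝ) = (p : ℝ) ^ (3 : ℕ) := by
        exact_mod_cast Real.rpow_natCast (p : ℝ) 3
      rw [h2]
      linarith [Real.pi_lt_d2]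
    have h3w : (p : ℝ) ^ w * (p ^ (2 * w) : ℕ) = (p : ℝ) ^ (3 * w : ℝ) := by
      push_cast
      rw [← pow_add, ← Real.rpow_natCast]
      congr 1
      push_cast
      ring
    rw [h3w]
    calc 4 * Real.pi * ((p : ℝ) ^ (3 * w : ℝ) * N)
        ≤ 4 * Real.pi * ((p : ℝ) ^ (3 * w : ℝ) * (2 * (p : ℝ) ^ ((n : ℝ) * (1 - lam)))) := by
          gcongr
      _ = 8 * Real.pi * ((p : ℝ) ^ (3 * w : ℝ) * (p : ℝ) ^ ((n : ℝ) * (1 - lam))) := by ring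
      _ ≤ (p : ℝ) ^ (3 : ℝ) * ((p : ℝ) ^ (3 * w : ℝ) * (p : ℝ) ^ ((n : ℝ) * (1 - lam))) := by
          gcongr
      _ = (p : ℝ) ^ (3 + (3 * w + n * (1 - lam)) : ℝ) := by
          rw [← Real.rpow_add hp0, ← Real.rpow_add hp0]
      _ ≤ (p : ℝ) ^ (n : ℝ) := Real.rpow_le_rpow_of_exponent_le hp1 (by linarith)
      _ = (p : ℝ) ^ n := Real.rpow_natCast _ _
  have hlow : (d + 1) * i + w * (d + 2) + L ≤ n := by
    have e1 : (d + 1) * i + 2 * i = D * i := by rw [hD]; ring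
    have e2 : w * (d + 2) + x = D * x + (d + 2) := by rw [hw, hD]; ring
    omega
  have hnw : n ≤ w * (d + 3) := by rw [mul_comm]; exact hxn'.le
  have hmain := norm_sum_kloostermanTerm_le hp2 (d := d) (w := w) (m := m) (k := w) (i := i)
    (V := p ^ (2 * w)) (N := N) (ε := ε) (by omega) (by omega) (by omega) hnw
    (hnw.trans (le_of_eq (by ring))) hlow (inv_le_one_of_one_le₀ (one_le_pow₀ hp1))
    (pow_pos hp.pos _) (hpow w (by omega)) (le_of_eq (inv_mul_cancel₀ hpi0.ne').symm)
    (by simpa using hpow 0 (by omega)) hNsmall (a : ZMod (p ^ n)) b (⌈s⌉ : ZMod (p ^ n))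
  -- The saving `p ^ (-2 n δ)` leaves `p ^ (n δ)` to absorb the logarithm.
  have hη : ε ^ ((1 / 2 : ℝ) ^ (d + 1)) ≤ (p : ℝ) ^ (-(2 * (n * δ)) : ℝ) := by
    rw [hε, ← Real.rpow_natCast, ← Real.rpow_neg hp0.le, ← Real.rpow_mul hp0.le]
    refine Real.rpow_le_rpow_of_exponent_le hp1 ?_
    rw [neg_mul, neg_le_neg_iff]
    have h1 : (n : ℝ) ≤ D ^ 2 * (i + 1 : ℕ) := by
      have : n ≤ D * (D * (i + 1)) := hxn'.le.trans (Nat.mul_le_mul_left D hix')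
      have h' : (n : ℝ) ≤ D * (D * (i + 1 : ℕ)) := by exact_mod_cast this
      calc (n : ℝ) ≤ _ := h'
        _ = _ := by ring
    calc 2 * (n * δ) = n / D ^ 2 * (1 / 2) ^ (d + 1) := by
          rw [hδ, div_pow, one_pow, pow_succ 2 (d + 1)]
          field_simp
      _ ≤ ((i + 1 : ℕ) : ℝ) * (1 / 2) ^ (d + 1) := by
          gcongr
          rw [div_le_iff₀ (by positivity)]
          linarith
  have hlog : 2 + Real.log ((p : ℝ) ^ n) ≤ (2 + 1 / δ) * (p : ℝ) ^ (n * δ : ℝ) := by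
    have h1 : (1 : ℝ) ≤ (p : ℝ) ^ (n * δ : ℝ) := Real.one_le_rpow hp1 (by positivity)
    have h2 : Real.log ((p : ℝ) ^ n) ≤ 1 / δ * (p : ℝ) ^ (n * δ : ℝ) := by
      have h3 := Real.log_le_rpow_div (x := (p : ℝ) ^ n) (by positivity) hδ0
      rw [← Real.rpow_natCast, ← Real.rpow_mul hp0.le] at h3
      rw [← Real.rpow_natCast]
      calc _ ≤ _ := h3
        _ = _ := by ring
    linarith
  have hm' : (p : ℝ) ^ m ≤ (p : ℝ) ^ ((n : ℝ) / 2) * (p : ℝ) ^ (1 / 2 : ℝ) := by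
    rw [← Real.rpow_add hp0, ← Real.rpow_natCast]
    refine Real.rpow_le_rpow_of_exponent_le hp1 ?_
    have : 2 * m ≤ n + 1 := by omega
    have h' : 2 * (m : ℝ) ≤ n + 1 := by exact_mod_cast this
    linarith
  have hlog0 : (0 : ℝ) ≤ Real.log ((p : ℝ) ^ n) := Real.log_nonneg (one_le_pow₀ hp1)
  calc _ ≤ (p : ℝ) ^ (-((n : ℝ) / 2)) * (40 * p ^ m * ε ^ ((1 / 2 : ℝ) ^ (d + 1)) *
        (2 + Real.log (p ^ n))) := by gcongr
    _ ≤ (p : ℝ) ^ (-((n : ℝ) / 2)) * (40 * ((p : ℝ) ^ ((n : ℝ) / 2) * (p : ℝ) ^ (1 / 2 : ℝ)) *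
        (p : ℝ) ^ (-(2 * (n * δ)) : ℝ) * ((2 + 1 / δ) * (p : ℝ) ^ (n * δ : ℝ))) := by gcongr
    _ = C₁ * (((p : ℝ) ^ (-((n : ℝ) / 2)) * (p : ℝ) ^ ((n : ℝ) / 2)) *
        ((p : ℝ) ^ (-(2 * (n * δ)) : ℝ) * (p : ℝ) ^ (n * δ : ℝ))) := by rw [hC₁]; ring
    _ = C₁ * (p : ℝ) ^ (-((n : ℝ) * δ)) := by
        rw [← Real.rpow_add hp0, ← Real.rpow_add hp0, neg_add_cancel, Real.rpow_zero, one_mul]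
        congr 2
        ring
    _ ≤ _ := by gcongr; linarith
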